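/- Let $X$ be a smooth complete irreducible curve over an algebraically closed field $k$ of characteristic zero, with canonical line bundle $\mathcal K_X$. The gonality $\mathrm{gon}(X)$ is the least $n$ for which $X$ carries a pencil $g^1_n$ (a linear series of degree $n$ and dimension $1$). For effective divisors $D, E$, write $(D,E)$ for their greatest common divisor. Let $\mathcal L$ be a nonspecial line bundle on $X$, i.e. $h^1(X,\mathcal L)=0$. A *presentation* of $\mathcal L$ of type $(d,e)$ is an isomorphism $\mathcal L\simeq \mathcal K_X(-D+E)$, recorded by the pair $(D,E)$ of divisors with $D\ge 0$, $E>0$, $(D,E)=0$, $h^0(X,\mathcal O_X(D))=1$, $\deg D=d$, $\deg E=e$. It is *nontrivial* if $d>0$, and *minimal* if $\deg E\le \deg E'$ for every presentation $(D',E')$ of $\mathcal L$. Two presentations are the same if their pairs of divisors are equal. **Theorem.** Let $(D,E)$ be a nontrivial presentation of $\mathcal L$ of type $(d,e)$ with $h^0(X,\mathcal O_X(E))=1$. (i) If $d+e\le \mathrm{gon}(X)$, then $(D,E)$ is a minimal presentation of $\mathcal L$. (ii) If $d+e<\mathrm{gon}(X)$, then $(D,E)$ is the unique minimal presentation of $\mathcal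 L$. (iii) Suppose $d+e=\mathrm{gon}(X)$, and let $(D_j,E_j)$, $j\in J$, be pairwise distinct presentations of $\mathcal L$ of the same type $(d,e)$, all different from $(D,E)$. Then for every $j\in J$ the complete linear systems $|D+E_j|$ and $|D_j+E|$ coincide and are a pencil $g^1_{\mathrm{gon}(X)}$, in particular $h^0(X,\mathcal O_X(D+E_j))=2$; and the pencils $|D+E_j|$, $j\in J$, are mutually distinct. -/

import Mathlib

open CategoryTheory AlgebraicGeometry TopologicalSpace Opposite

universe u

/-- A smooth (complete, irreducible) curve over `k`: an integral scheme, proper and smooth of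
relative dimension one over `Spec k`. -/
structure SmoothCurve (k : Type u) [Field k] where
  /-- the underlying scheme -/
  X : Scheme.{u}
  /-- the structure morphism -/
  str : X ⟶ Spec (CommRingCat.of k)
  [isIntegral : IsIntegral X]
  [isProper : IsProper str]
  [isSmooth : SmoothOfRelativeDimension 1 str]

noncomputable section

namespace SmoothCurve

/-! ### Local rings of a smooth curve -/

theorem isDiscreteValuationRing_of_isStandardSmooth (F : Type*) [Field F] (A S : Type*)
    [CommRing A] [CommRing S] [Algebra F A]
    [Algebra.IsStandardSmoothOfRelativeDimension 1 F A] (q : Ideal A) [q.IsPrime] [Algebra A S]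
    [IsLocalization.AtPrime S q] [IsDomain S] (hS : ¬ IsField S) :
    IsDiscreteValuationRing S := by
  obtain ⟨g, hg⟩ :=
    Algebra.IsStandardSmoothOfRelativeDimension.exists_etale_mvPolynomial 1 F A
  let R := MvPolynomial (Fin 1) F
  have hR : IsPrincipalIdealRing R :=
    IsPrincipalIdealRing.of_surjective
      (MvPolynomial.uniqueAlgEquiv F (Fin 1)).symm.toRingEquiv.toRingHom
      (MvPolynomial.uniqueAlgEquiv F (Fin 1)).symm.surjective
  algebraize [g.toRingHom, (algebraMap A S).comp g.toRingHom]
  have : IsLocalRing S := IsLocalization.AtPrime.isLocalRing S q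
  have : IsNoetherianRing A := Algebra.FiniteType.isNoetherianRing R A
  have : IsNoetherianRing S := IsLocalization.isNoetherianRing q.primeCompl S inferInstance
  have : Algebra.FormallyUnramified A S := .of_isLocalization q.primeCompl
  have : Algebra.FormallyUnramified R S := .comp _ A _
  have : Algebra.EssFiniteType A S := .of_isLocalization _ q.primeCompl
  have : Algebra.EssFiniteType R S := .comp _ A _
  let p : Ideal R := (IsLocalRing.maximalIdeal S).comap (algebraMap R S)
  have hp : ∀ y : p.primeCompl, IsUnit (algebraMap R S y) := fun y ↦ by
    by_contra h
    exact y.2 ((IsLocalRing.mem_maximalIdeal _).mpr h)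
  let φ : Localization.AtPrime p →+* S := IsLocalization.lift hp
  algebraize [φ]
  have hφ : ∀ x, algebraMap (Localization.AtPrime p) S (algebraMap R _ x) = algebraMap R S x :=
    fun x ↦ IsLocalization.lift_eq hp x
  have : IsScalarTower R (Localization.AtPrime p) S := .of_algebraMap_eq fun x ↦ (hφ x).symm
  have : IsLocalHom (algebraMap (Localization.AtPrime p) S) := by
    constructor
    intro a ha
    obtain ⟨x, y, rfl⟩ := IsLocalization.exists_mk'_eq p.primeCompl a
    rw [IsLocalization.AtPrime.isUnit_mk'_iff _ p]
    rw [RingHom.algebraMap_toAlgebra, IsLocalization.lift_mk', IsUnit.mul_iff] at ha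
    exact fun h ↦ (IsLocalRing.mem_maximalIdeal _).mp h ha.1
  have : Algebra.FormallyUnramified (Localization.AtPrime p) S := .of_restrictScalars R _ _
  have : Algebra.EssFiniteType (Localization.AtPrime p) S := .of_comp R _ _
  have hmax : (IsLocalRing.maximalIdeal S).IsPrincipal := by
    rw [← Algebra.FormallyUnramified.map_maximalIdeal (R := Localization.AtPrime p),
      ← Localization.AtPrime.map_eq_maximalIdeal, Ideal.map_map, ← IsScalarTower.algebraMap_eq]
    obtain ⟨a, ha⟩ := (IsPrincipalIdealRing.principal p).principal
    exact ⟨algebraMap R S a, by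
      rw [show Ideal.map (algebraMap R S) p = _ from congrArg _ ha, Ideal.submodule_span_eq,
        Ideal.map_span, Set.image_singleton, Ideal.submodule_span_eq]⟩
  exact ((IsDiscreteValuationRing.TFAE S hS).out 0 4).mpr hmax

variable {k : Type u} [Field k] (C : SmoothCurve k)

attribute [instance] isIntegral isProper isSmooth

instance : IsLocallyNoetherian C.X := LocallyOfFiniteType.isLocallyNoetherian C.str

/-- The function field `k(X)` is an extension of `k`. -/
instance : Algebra k C.X.functionField :=
  ((C.X.presheaf.germ ⊤ (genericPoint C.X) trivial).hom.comp
    (C.str.appTop.hom.comp (Scheme.ΓSpecIso (CommRingCat.of k)).inv.hom)).toAlgebra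

/-- The closed points of the curve, i.e. its points of codimension one. -/
abbrev Point := {x : C.X // Order.coheight x = 1}

/-- The local ring of a smooth curve at a closed point is a discrete valuation ring. -/
instance isDiscreteValuationRing_stalk (P : C.Point) :
    IsDiscreteValuationRing (C.X.presheaf.stalk P.1) := by
  obtain ⟨U, hU, V, hV, hxV, e, hf⟩ :=
    C.isSmooth.exists_isStandardSmoothOfRelativeDimension P.1
  have hUne : Nonempty U := ⟨⟨C.str P.1, e hxV⟩⟩
  have : Subsingleton (Spec (CommRingCat.of k)) :=
    inferInstanceAs (Subsingleton (PrimeSpectrum k))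
  have : Subsingleton U.toScheme := ⟨fun x y ↦ Subtype.ext (Subsingleton.elim (α := Spec (CommRingCat.of k)) x.1 y.1)⟩
  have hfld : IsField Γ(Spec (CommRingCat.of k), U) := by
    have h := isField_of_isIntegral_of_subsingleton U.toScheme
    exact MulEquiv.isField h (U.topIso.commRingCatIsoToRingEquiv.symm.toMulEquiv)
  let := hfld.toField
  let := (C.str.appLE U V e).hom.toAlgebra
  have : Algebra.IsStandardSmoothOfRelativeDimension 1 Γ(Spec (CommRingCat.of k), U) Γ(C.X, V) :=
    hf
  let := TopCat.Presheaf.algebra_section_stalk C.X.presheaf (⟨P.1, hxV⟩ : V)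
  have := hV.isLocalization_stalk ⟨P.1, hxV⟩
  refine isDiscreteValuationRing_of_isStandardSmooth Γ(Spec (CommRingCat.of k), U) Γ(C.X, V) _
    (hV.primeIdealOf ⟨P.1, hxV⟩).asIdeal fun h ↦ ?_
  have h0 := ringKrullDim_eq_zero_of_isField h
  rw [ringKrullDim_stalk_eq_coheight, P.2] at h0
  exact one_ne_zero h0

/-! ### Divisors and linear systems -/

/-- The order of vanishing at `P` of a nonzero rational function (with the value `0` for the zero
function). -/
def ord (P : C.Point) (f : C.X.functionField) : ℤ := Scheme.ord f P.1

/-- Divisors. The order is coefficientwise, so `D ⊓ E` is the greatest common divisor. -/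
abbrev Divisor := C.Point →₀ ℤ

variable {C}

/-- The degree of a divisor (over an algebraically closed field). -/
def deg (A : C.Divisor) : ℤ := A.sum fun _ n ↦ n

/-- Linear equivalence: `A = B + div f` for a nonzero rational function `f`. -/
def LinEquiv (A B : C.Divisor) : Prop :=
  ∃ f : C.X.functionField, f ≠ 0 ∧ ∀ P, A P = B P + C.ord P f

/-- The complete linear system `|A|`. -/
def completeLinearSystem (A : C.Divisor) : Set C.Divisor :=
  {B | 0 ≤ B ∧ LinEquiv B A}

/-- `f` is a section of `𝒪_X(A)` at `P`: either `f = 0` or `ord_P f + A(P) ≥ 0`. -/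
def RegularAt (A : C.Divisor) (P : C.Point) (f : C.X.functionField) : Prop :=
  f = 0 ∨ 0 ≤ C.ord P f + A P

theorem RegularAt.add {A : C.Divisor} {P : C.Point} {f g : C.X.functionField}
    (hf : RegularAt A P f) (hg : RegularAt A P g) : RegularAt A P (f + g) := by
  by_cases h : f + g = 0
  · exact Or.inl h
  rcases hf with rfl | hf
  · rwa [zero_add]
  rcases hg with rfl | hg
  · rw [add_zero]; exact Or.inr hf
  have := Scheme.ord_add (x := P.1) h
  refine Or.inr ?_
  unfold ord at *
  rcases min_le_iff.mp this with h | h <;> omega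

theorem RegularAt.mul {A : C.Divisor} {P : C.Point} {f a : C.X.functionField}
    (hf : RegularAt A P f) (ha : a = 0 ∨ 0 ≤ C.ord P a) : RegularAt A P (a * f) := by
  rcases hf with rfl | hf
  · exact Or.inl (mul_zero a)
  rcases ha with rfl | ha
  · exact Or.inl (zero_mul f)
  by_cases hf0 : f = 0
  · exact Or.inl (by rw [hf0, mul_zero])
  by_cases ha0 : a = 0
  · exact Or.inl (by rw [ha0, zero_mul])
  refine Or.inr ?_
  unfold ord at *
  rw [Scheme.ord_mul ha0 hf0]
  omega

theorem ord_germ {U : C.X.Opens} (P : C.Point) (hP : P.1 ∈ U) (a : Γ(C.X, U)) :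
    algebraMap (C.X.presheaf.stalk P.1) C.X.functionField (C.X.presheaf.germ U P.1 hP a) = 0 ∨
      0 ≤ C.ord P (algebraMap (C.X.presheaf.stalk P.1) C.X.functionField
        (C.X.presheaf.germ U P.1 hP a)) := by
  have : Nonempty U := ⟨⟨P.1, hP⟩⟩
  by_cases ha : a = 0
  · left
    simp [ha]
  right
  have h := Scheme.ord_le_smul hP ha (1 : C.X.functionField)
  have h1 : Scheme.ord (1 : C.X.functionField) P.1 = 0 := by
    have := Scheme.ord_mul (x := P.1) (one_ne_zero (α := C.X.functionField)) one_ne_zero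
    rw [mul_one] at this
    omega
  rw [h1, Algebra.smul_def, mul_one] at h
  rw [Scheme.algebraMap_germ_eq_germToFunctionField]
  exact h

/-- The Riemann–Roch space `L(A) = H⁰(X, 𝒪_X(A))`. -/
def riemannRochSpace (A : C.Divisor) : Submodule k C.X.functionField where
  carrier := {f | ∀ P, RegularAt A P f}
  zero_mem' P := Or.inl rfl
  add_mem' hf hg P := (hf P).add (hg P)
  smul_mem' c f hf P := by
    rw [Algebra.smul_def]
    refine (hf P).mul ?_
    have h := ord_germ (U := ⊤) P trivial
      (C.str.appTop.hom ((Scheme.ΓSpecIso (CommRingCat.of k)).inv.hom c))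
    have : Nonempty (⊤ : C.X.Opens) := ⟨⟨P.1, trivial⟩⟩
    have e := Scheme.algebraMap_germ_eq_germToFunctionField C.X (U := ⊤) (x := P.1) trivial
      (C.str.appTop.hom ((Scheme.ΓSpecIso (CommRingCat.of k)).inv.hom c))
    rwa [show algebraMap (C.X.presheaf.stalk P.1) C.X.functionField (C.X.presheaf.germ ⊤ P.1 trivial
      (C.str.appTop.hom ((Scheme.ΓSpecIso (CommRingCat.of k)).inv.hom c))) =
        algebraMap k C.X.functionField c from e] at h

/-- `h⁰(X, 𝒪_X(A))`. -/
def h0 (A : C.Divisor) : ℕ := Module.finrank k (riemannRochSpace A)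

/-- `S` is a linear series `g^r_d`: the divisors `A + div f`, `0 ≠ f ∈ V`, for a divisor `A` of
degree `d` and a subspace `V` of dimension `r + 1` of `L(A)`. -/
def IsLinearSeries (r d : ℕ) (S : Set C.Divisor) : Prop :=
  ∃ (A : C.Divisor) (V : Submodule k C.X.functionField), V ≤ riemannRochSpace A ∧
    Module.finrank k V = r + 1 ∧ deg A = d ∧
    S = {B | ∃ f ∈ V, f ≠ 0 ∧ ∀ P, B P = A P + C.ord P f}

variable (C) in
/-- The gonality: the least `n` such that the curve carries a pencil `g^1_n`. -/
def gonality : ℕ := sInf {n | ∃ S : Set C.Divisor, IsLinearSeries 1 n S}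

/-- `K` is a canonical divisor: the divisor of a nonzero rational differential `ω`, whose order at
`P` is the order of `g` when `ω = g dt` with `t` a uniformizer at `P`. -/
def IsCanonical (K : C.Divisor) : Prop :=
  ∃ ω : Ω[C.X.functionField⁄k], ω ≠ 0 ∧
    ∀ (P : C.Point) (t : C.X.functionField), C.ord P t = 1 →
      ∃ g : C.X.functionField, ω = g • KaehlerDifferential.D k C.X.functionField t ∧
        K P = C.ord P g

/-! ### Line bundles -/

/-- The sections of `𝒪_X(A)` over `U`: the sections `s` over `U` of the constant sheaf `k(X)` (these
are the constant functions on `U`, as `X` is irreducible, and `0` if `U` is empty) which at every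
closed point `P` of `U` are zero or satisfy `ord_P s + A(P) ≥ 0`. -/
def sections (A : C.Divisor) (U : C.X.Opens) : AddSubgroup (U → C.X.functionField) where
  carrier := {s | (∀ x y, s x = s y) ∧ ∀ (P : C.Point) (h : P.1 ∈ U), RegularAt A P (s ⟨P.1, h⟩)}
  zero_mem' := ⟨fun _ _ ↦ rfl, fun _ _ ↦ Or.inl rfl⟩
  add_mem' hs ht := ⟨fun x y ↦ congrArg₂ (· + ·) (hs.1 x y) (ht.1 x y),
    fun P h ↦ (hs.2 P h).add (ht.2 P h)⟩
  neg_mem' {s} hs := ⟨fun x y ↦ congrArg (- ·) (hs.1 x y), fun P h ↦ by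
    have h1 : (1 : C.X.functionField) ≠ 0 := one_ne_zero
    have h2 := Scheme.ord_mul (x := P.1) h1 h1
    have h3 := Scheme.ord_mul (x := P.1) (neg_ne_zero.mpr h1) (neg_ne_zero.mpr h1)
    rw [mul_one] at h2
    rw [neg_mul_neg, mul_one] at h3
    have := (hs.2 P h).mul (a := -1) (Or.inr (by unfold ord; omega))
    rwa [neg_one_mul] at this⟩

theorem algebraMap_germ_eq {U : C.X.Opens} (x y : U) (a : Γ(C.X, U)) :
    algebraMap (C.X.presheaf.stalk x.1) C.X.functionField (C.X.presheaf.germ U x.1 x.2 a) =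
      algebraMap (C.X.presheaf.stalk y.1) C.X.functionField
        (C.X.presheaf.germ U y.1 y.2 a) := by
  have : Nonempty U := ⟨x⟩
  rw [Scheme.algebraMap_germ_eq_germToFunctionField, Scheme.algebraMap_germ_eq_germToFunctionField]

/-- Regular functions on `U` act on the sections of `𝒪_X(A)` by multiplication in `k(X)`. -/
instance (A : C.Divisor) (U : C.X.Opens) : Module Γ(C.X, U) (sections A U) where
  smul a s := ⟨fun x ↦ algebraMap (C.X.presheaf.stalk x.1) C.X.functionField
      (C.X.presheaf.germ U x.1 x.2 a) * s.1 x,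
    fun x y ↦ congrArg₂ (· * ·) (algebraMap_germ_eq x y a) (s.2.1 x y),
    fun P h ↦ (s.2.2 P h).mul (ord_germ P h a)⟩
  one_smul s := Subtype.ext <| funext fun x ↦ by
    change algebraMap _ _ (C.X.presheaf.germ U x.1 x.2 1) * s.1 x = s.1 x
    rw [map_one, map_one, one_mul]
  mul_smul a b s := Subtype.ext <| funext fun x ↦ by
    change algebraMap _ _ (C.X.presheaf.germ U x.1 x.2 (a * b)) * s.1 x =
      algebraMap _ _ (C.X.presheaf.germ U x.1 x.2 a) *
        (algebraMap _ _ (C.X.presheaf.germ U x.1 x.2 b) * s.1 x)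
    rw [map_mul, map_mul, mul_assoc]
  smul_zero a := Subtype.ext <| funext fun x ↦ mul_zero _
  smul_add a s t := Subtype.ext <| funext fun x ↦ mul_add _ _ _
  add_smul a b s := Subtype.ext <| funext fun x ↦ by
    change algebraMap _ _ (C.X.presheaf.germ U x.1 x.2 (a + b)) * s.1 x =
      algebraMap _ _ (C.X.presheaf.germ U x.1 x.2 a) * s.1 x +
        algebraMap _ _ (C.X.presheaf.germ U x.1 x.2 b) * s.1 x
    rw [map_add, map_add, add_mul]
  zero_smul s := Subtype.ext <| funext fun x ↦ by
    change algebraMap _ _ (C.X.presheaf.germ U x.1 x.2 0) * s.1 x = 0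
    rw [map_zero, map_zero, zero_mul]

theorem smul_apply {A : C.Divisor} {U : C.X.Opens} (a : Γ(C.X, U)) (s : sections A U) (x : U) :
    (a • s).1 x = algebraMap (C.X.presheaf.stalk x.1) C.X.functionField
      (C.X.presheaf.germ U x.1 x.2 a) * s.1 x := rfl

/-- Restriction of sections of `𝒪_X(A)`. -/
def restrictSections (A : C.Divisor) {U V : C.X.Opens} (i : V ≤ U) :
    sections A U →+ sections A V where
  toFun s := ⟨fun x ↦ s.1 ⟨x.1, i x.2⟩, fun _ _ ↦ s.2.1 _ _, fun P h ↦ s.2.2 P (i h)⟩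
  map_zero' := rfl
  map_add' _ _ := rfl

/-- The underlying presheaf of abelian groups of `𝒪_X(A)`. -/
def presheaf (A : C.Divisor) : TopCat.Presheaf AddCommGrpCat.{u} C.X where
  obj U := AddCommGrpCat.of (sections A U.unop)
  map i := AddCommGrpCat.ofHom (restrictSections A (leOfHom i.unop))
  map_id _ := rfl
  map_comp _ _ := rfl

instance (A : C.Divisor) (U : (C.X.Opens)ᵒᵖ) :
    Module (C.X.ringCatSheaf.obj.obj U) ((presheaf A).obj U) :=
  inferInstanceAs (Module Γ(C.X, U.unop) (sections A U.unop))

theorem presheaf_isSheaf (A : C.Divisor) : TopCat.Presheaf.IsSheaf (presheaf A) := by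
  rw [TopCat.Presheaf.isSheaf_iff_isSheafUniqueGluing]
  intro ι U sf hsf
  have key : ∀ i j (x : C.X) (hi : x ∈ U i) (hj : x ∈ U j),
      (sf i : sections A (U i)).1 ⟨x, hi⟩ = (sf j : sections A (U j)).1 ⟨x, hj⟩ := by
    intro i j x hi hj
    exact congrFun (congrArg Subtype.val (hsf i j)) ⟨x, hi, hj⟩
  have hcov : ∀ x : ↥(iSup U : C.X.Opens), ∃ i, x.1 ∈ U i := fun x ↦ Opens.mem_iSup.mp x.2
  choose c hc using hcov
  let s : ↥(iSup U : C.X.Opens) → C.X.functionField :=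
    fun x ↦ (sf (c x) : sections A (U (c x))).1 ⟨x.1, hc x⟩
  have hs : ∀ i (x : C.X) (hi : x ∈ U i), s ⟨x, Opens.mem_iSup.mpr ⟨i, hi⟩⟩ =
      (sf i : sections A (U i)).1 ⟨x, hi⟩ := fun i x hi ↦ key _ _ _ _ _
  have hmem : s ∈ sections A (iSup U) := by
    refine ⟨fun x y ↦ ?_, fun P h ↦ (sf (c ⟨P.1, h⟩) : sections A _).2.2 P _⟩
    have hη : ∀ z : ↥(iSup U : C.X.Opens), genericPoint C.X ∈ U (c z) := fun z ↦
      ((genericPoint_spec C.X).mem_open_set_iff (U (c z)).isOpen).mpr ⟨z.1, trivial, hc z⟩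
    have hz : ∀ z : ↥(iSup U : C.X.Opens), s z =
        s ⟨genericPoint C.X, Opens.mem_iSup.mpr ⟨c z, hη z⟩⟩ := fun z ↦ by
      rw [hs (c z) _ (hη z)]
      exact (sf (c z) : sections A _).2.1 _ _
    rw [hz x, hz y]
  refine ⟨(⟨s, hmem⟩ : sections A (iSup U)), fun i ↦ ?_, fun t ht ↦ ?_⟩
  · exact Subtype.ext (funext fun x ↦ hs i x.1 x.2)
  · refine Subtype.ext (funext fun x ↦ ?_)
    exact congrFun (congrArg Subtype.val (ht (c x))) ⟨x.1, hc x⟩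

/-- The line bundle `𝒪_X(A)` of a divisor `A`. -/
def lineBundle (A : C.Divisor) : C.X.Modules where
  val := PresheafOfModules.ofPresheaf (R := C.X.ringCatSheaf.obj) (presheaf A) (by
    intro U V i a s
    refine Subtype.ext (funext fun x ↦ ?_)
    refine congrArg (· * (s : sections A U.unop).1 ⟨x.1, leOfHom i.unop x.2⟩) ?_
    refine congrArg _ ?_
    exact (C.X.presheaf.germ_res_apply i.unop x.1 x.2 a).symm)
  isSheaf := presheaf_isSheaf A

/-- A sheaf of modules which is locally isomorphic to the structure sheaf. -/
def IsLineBundle (L : C.X.Modules) : Prop :=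
  ∀ x : C.X, ∃ U : C.X.Opens, x ∈ U ∧
    Nonempty (L.restrict U.ι ≅ (SheafOfModules.unit U.toScheme.ringCatSheaf : U.toScheme.Modules))

/-- `L` is nonspecial: `H¹(X, L) = 0`. -/
def IsNonspecial (L : C.X.Modules) : Prop :=
  Subsingleton (Sheaf.H (⟨L.presheaf, L.isSheaf⟩ : TopCat.Sheaf AddCommGrpCat.{u} C.X) 1)

/-! ### Presentations -/

/-- `L ≃ 𝒦_X - D + E` is a presentation of `L`: `D` and `E` are effective without common points,
`h⁰(X, 𝒪_X(D)) = 1` and `E > 0`. Here `𝒦_X` is the line bundle of a canonical divisor. -/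
structure IsPresentation (L : C.X.Modules) (D E : C.Divisor) : Prop where
  nonneg : 0 ≤ D
  h0_eq_one : h0 D = 1
  pos : 0 < E
  gcd_eq_zero : D ⊓ E = 0
  iso : ∃ K : C.Divisor, IsCanonical K ∧ Nonempty (L ≅ lineBundle (K - D + E))

/-- A presentation `L ≃ 𝒦_X - D + E` is minimal if `deg E` is minimal among all presentations. -/
structure IsMinimalPresentation (L : C.X.Modules) (D E : C.Divisor) : Prop where
  isPresentation : IsPresentation L D E
  deg_le : ∀ D' E' : C.Divisor, IsPresentation L D' E' → deg E ≤ deg E'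

end SmoothCurve

end

/-!
The starting point is that two presentations `(D, E)` and `(D', E')` of the same line bundle give
linearly equivalent effective divisors `D + E'` and `D' + E` (`IsPresentation.linEquiv`). Since
`D`, `E` have no common points, and neither have `D'`, `E'`, these two divisors are equal only if
the presentations are (`eq_of_add_eq_add`). Otherwise they differ by the divisor of a nonconstant
function `f`, and `1`, `f` span a pencil of degree `deg D + deg E'`; hence this degree is at least
the gonality (`IsPresentation.gonality_le_deg`). A presentation with `deg E' < deg E`, or a
different one with `deg E' = deg E` when `deg D + deg E` is less than the gonality, contradicts
this bound.

When `deg D + deg E` is the gonality, `|D + E'|` contains a pencil, and it is not larger, because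
imposing a base point lowers the dimension by at most one, while a pencil of degree one less than
the gonality does not exist (`h0_eq_two`). If `|D + E₁| = |D + E₂|`, then `E₁ ~ E₂`, and also
`D₁ ~ D₂` since `|D + Eᵢ| = |Dᵢ + E|`; these divisors are effective of degree less than the
gonality, so they are equal.

The geometric input is the passage from line bundles to divisors. A morphism `𝒪_X(A) ⟶ 𝒪_X(B)` is
the multiplication by a rational function, and local generators of `𝒪_X(A)` compare its order with
`A` and `B` (`linEquiv_of_iso`). Canonical divisors are linearly equivalent because the
differentials that define them are multiples of the same `dt` (`IsCanonical.linEquiv`). The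
codimension count at a base point uses that the residue field of a closed point of the curve is `k`
(`exists_sub_constants_mem_maximalIdeal`).
-/

noncomputable section

namespace SmoothCurve

variable {k : Type u} [Field k] {C : SmoothCurve k}

/-! ### Orders of rational functions -/

theorem ord_mul (P : C.Point) {f g : C.X.functionField} (hf : f ≠ 0) (hg : g ≠ 0) :
    C.ord P (f * g) = C.ord P f + C.ord P g :=
  Scheme.ord_mul hf hg

theorem ord_one (P : C.Point) : C.ord P 1 = 0 := by
  have := ord_mul P (one_ne_zero (α := C.X.functionField)) one_ne_zero
  rw [mul_one] at this
  omega

theorem ord_inv (P : C.Point) {f : C.X.functionField} (hf : f ≠ 0) :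
    C.ord P f⁻¹ = - C.ord P f := by
  have := ord_mul P hf (inv_ne_zero hf)
  rw [mul_inv_cancel₀ hf, ord_one] at this
  omega

theorem ord_zpow (P : C.Point) {f : C.X.functionField} (hf : f ≠ 0) (n : ℤ) :
    C.ord P (f ^ n) = n * C.ord P f := by
  induction n with
  | zero => simp [ord_one]
  | succ n ih => rw [zpow_add_one₀ hf, ord_mul P (zpow_ne_zero _ hf) hf, ih]; ring
  | pred n ih =>
    rw [zpow_sub_one₀ hf, ord_mul P (zpow_ne_zero _ hf) (inv_ne_zero hf), ih, ord_inv P hf]; ring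

theorem ord_algebraMap (P : C.Point) {c : k} (hc : c ≠ 0) :
    C.ord P (algebraMap k C.X.functionField c) = 0 := by
  have key : ∀ a : k, a ≠ 0 → 0 ≤ C.ord P (algebraMap k C.X.functionField a) := by
    intro a ha
    have h : algebraMap k C.X.functionField a ∈ riemannRochSpace (0 : C.Divisor) := by
      rw [Algebra.algebraMap_eq_smul_one]
      exact Submodule.smul_mem _ _ fun Q ↦ Or.inr (by simp [ord_one])
    rcases h P with h | h
    · exact absurd h ((map_ne_zero _).mpr ha)
    · simpa using h
  have h1 := key c hc
  have h2 := key c⁻¹ (inv_ne_zero hc)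
  rw [map_inv₀, ord_inv P ((map_ne_zero _).mpr hc)] at h2
  omega

theorem ord_stalk_nonneg (P : C.Point) (a : C.X.presheaf.stalk P.1) (ha : a ≠ 0) :
    0 ≤ C.ord P (algebraMap _ C.X.functionField a) := by
  have : Ring.KrullDimLE 1 (C.X.presheaf.stalk P.1) := krullDimLE_of_coheight_le P.2.le
  have ha' : algebraMap _ C.X.functionField a ≠ 0 := by simpa using ha
  exact (Scheme.le_ord_iff P.2 ha').mpr (Ring.ordFrac_ge_one_of_ne_zero ha)

/-- The local ring at `P` is the valuation ring of `ord_P`. -/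
theorem exists_stalk_eq (P : C.Point) {f : C.X.functionField} (h : 0 ≤ C.ord P f) :
    ∃ a : C.X.presheaf.stalk P.1, algebraMap _ C.X.functionField a = f := by
  by_cases hf : f = 0
  · exact ⟨0, by rw [map_zero, hf]⟩
  rcases ValuationRing.isInteger_or_isInteger (C.X.presheaf.stalk P.1) f with ⟨a, ha⟩ | ⟨a, ha⟩
  · exact ⟨a, ha⟩
  have ha0 : a ≠ 0 := by
    rintro rfl
    rw [map_zero] at ha
    exact inv_ne_zero hf ha.symm
  have h0 : C.ord P (algebraMap _ C.X.functionField a) = 0 := by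
    have := ord_stalk_nonneg P a ha0
    rw [ha, ord_inv P hf] at this ⊢
    omega
  have hu : IsUnit a := by
    have : Ring.KrullDimLE 1 (C.X.presheaf.stalk P.1) := krullDimLE_of_coheight_le P.2.le
    rw [Ring.isUnit_iff_ordFrac_one_of_isDiscreteValuationRing (K := C.X.functionField)]
    exact (Scheme.ord_eq_iff P.2 (by simpa using ha0)).mp h0
  obtain ⟨b, hb⟩ := hu.exists_right_inv
  refine ⟨b, ?_⟩
  have := congrArg (algebraMap _ C.X.functionField) hb
  rw [map_mul, map_one, ha] at this
  exact (eq_of_inv_mul_eq_one this).symm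

theorem ord_pos_of_mem_maximalIdeal (P : C.Point) {a : C.X.presheaf.stalk P.1} (ha : a ≠ 0)
    (hm : a ∈ IsLocalRing.maximalIdeal (C.X.presheaf.stalk P.1)) :
    0 < C.ord P (algebraMap _ C.X.functionField a) := by
  have : Ring.KrullDimLE 1 (C.X.presheaf.stalk P.1) := krullDimLE_of_coheight_le P.2.le
  refine lt_of_le_of_ne (ord_stalk_nonneg P a ha) fun h ↦ ?_
  refine (IsLocalRing.mem_maximalIdeal _).mp hm ?_
  rw [Ring.isUnit_iff_ordFrac_one_of_isDiscreteValuationRing (K := C.X.functionField)]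
  exact (Scheme.ord_eq_iff P.2 (by simpa using ha)).mp h.symm

theorem exists_ord_eq_one (P : C.Point) : ∃ t : C.X.functionField, t ≠ 0 ∧ C.ord P t = 1 := by
  have : Ring.KrullDimLE 1 (C.X.presheaf.stalk P.1) := krullDimLE_of_coheight_le P.2.le
  obtain ⟨ϖ, hϖ⟩ := IsDiscreteValuationRing.exists_irreducible (C.X.presheaf.stalk P.1)
  have h0 : algebraMap _ C.X.functionField ϖ ≠ 0 := by simpa using hϖ.ne_zero
  exact ⟨_, h0, (Scheme.ord_eq_iff P.2 h0).mpr (Ring.ordFrac_irreducible hϖ)⟩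

/-! ### Finiteness of zeros and poles -/

instance : CompactSpace C.X :=
  (quasiCompact_iff_compactSpace (f := C.str)).mp inferInstance

theorem genericPoint_mem (U : C.X.Opens) [hU : Nonempty U] : genericPoint C.X ∈ U :=
  ((genericPoint_spec C.X).mem_open_set_iff U.isOpen).mpr
    (by obtain ⟨x⟩ := hU; exact ⟨x.1, trivial, x.2⟩)

/-- A nonempty open set contains all but finitely many closed points: a point of codimension one of
its complement is the generic point of one of the finitely many components of the complement. -/
theorem finite_points_notMem (U : C.X.Opens) [Nonempty U] :
    {P : C.Point | P.1 ∉ U}.Finite := by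
  have : IsNoetherian C.X := {}
  have : NoetherianSpace C.X := inferInstance
  obtain ⟨S, hS, hcl, hirr, hun⟩ := NoetherianSpace.exists_finite_set_isClosed_irreducible
    (s := (U : Set C.X)ᶜ) U.isOpen.isClosed_compl
  have hmaps : ∀ P : C.Point, P.1 ∉ U → closure {P.1} ∈ S := by
    intro P hP
    obtain ⟨t, ht, hPt⟩ : P.1 ∈ ⋃₀ S := hun ▸ hP
    obtain ⟨η, hη⟩ := QuasiSober.sober (hirr t ht) (hcl t ht)
    have hηU : η ∉ U := by
      have : η ∈ (U : Set C.X)ᶜ := hun ▸ ⟨t, ht, hη.mem⟩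
      exact this
    have hspec : η ⤳ P.1 := hη.specializes hPt
    have hgen : genericPoint C.X ⤳ η := (genericPoint_spec C.X).specializes trivial
    have hlt : η < genericPoint C.X := lt_of_le_not_ge hgen fun h ↦
      hηU (Specializes.mem_open h U.isOpen (genericPoint_mem U))
    have hnot : ¬ P.1 < η := fun hP' ↦ by
      have h1 := Order.coheight_add_one_le hlt
      have h2 := Order.coheight_add_one_le hP'
      rw [P.2] at h2
      have h3 : (1 : ℕ∞) ≤ Order.coheight η := le_trans le_add_self h1
      have h4 : (1 : ℕ∞) + 1 ≤ 1 := le_trans (by gcongr) h2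
      exact absurd h4 (by decide)
    have heq : P.1 = η := by
      by_contra hne
      refine hnot (lt_of_le_not_ge hspec fun h' ↦ hne ?_)
      exact (Specializes.antisymm h' hspec).eq
    rw [heq, hη.def]
    exact ht
  refine Set.Finite.of_finite_image (f := fun P : C.Point ↦ closure {P.1})
    (hS.subset (Set.image_subset_iff.mpr hmaps)) ?_
  intro P _ Q _ h
  have h : IsGenericPoint P.1 (closure {Q.1}) := h
  exact Subtype.ext (h.eq rfl)

theorem finite_ord_ne_zero {f : C.X.functionField} (hf : f ≠ 0) :
    {P : C.Point | C.ord P f ≠ 0}.Finite := by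
  obtain ⟨U, -, f', hU, rfl, hunit⟩ := exists_isUnit_germ_eq C.X f hf
  refine (finite_points_notMem U).subset fun P hP hPU ↦ hP ?_
  exact Scheme.ord_of_isUnit hunit hPU

/-- There are no specializations between distinct points of codimension one. -/
theorem Point.eq_of_specializes {P Q : C.Point} (h : Q.1 ⤳ P.1) : Q = P := by
  by_contra hne
  have hlt : P.1 < Q.1 := by
    refine lt_of_le_not_ge h fun h' ↦ hne (Subtype.ext ?_)
    exact (Specializes.antisymm h h').eq
  have := Order.coheight_add_one_le hlt
  rw [P.2, Q.2] at this
  exact absurd this (by decide)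

/-- A finite set of points can be removed from the curve. They are only known to have codimension
one, so their closures are removed. -/
theorem exists_open_avoiding {S : Set C.Point} (hS : S.Finite) {P : C.Point} (hP : P ∉ S) :
    ∃ U : C.X.Opens, P.1 ∈ U ∧ ∀ Q ∈ S, Q.1 ∉ U := by
  refine ⟨⟨(⋃ Q ∈ S, closure {Q.1})ᶜ,
    (hS.isClosed_biUnion fun Q _ ↦ isClosed_closure).isOpen_compl⟩, ?_, ?_⟩
  · intro h
    obtain ⟨Q, hQ, h⟩ := Set.mem_iUnion₂.mp h
    exact hP (Point.eq_of_specializes (specializes_iff_mem_closure.mpr h) ▸ hQ)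
  · exact fun Q hQ h ↦ h (Set.mem_iUnion₂.mpr ⟨Q, hQ, subset_closure rfl⟩)

/-! ### Morphisms between the line bundles of divisors -/

theorem LinEquiv.symm {A B : C.Divisor} (h : LinEquiv A B) : LinEquiv B A := by
  obtain ⟨f, hf, h⟩ := h
  exact ⟨f⁻¹, inv_ne_zero hf, fun P ↦ by rw [ord_inv P hf, h P]; ring⟩

theorem LinEquiv.trans {A B B' : C.Divisor} (h : LinEquiv A B) (h' : LinEquiv B B') :
    LinEquiv A B' := by
  obtain ⟨f, hf, h⟩ := h
  obtain ⟨g, hg, h'⟩ := h'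
  exact ⟨f * g, mul_ne_zero hf hg, fun P ↦ by rw [ord_mul P hf hg, h P, h' P]; ring⟩

/-- The rational function underlying a section of `𝒪_X(A)` over a nonempty open set. -/
def sectionValue {A : C.Divisor} {U : C.X.Opens} [Nonempty U] (s : sections A U) :
    C.X.functionField :=
  s.1 ⟨genericPoint C.X, genericPoint_mem U⟩

theorem sectionValue_eq {A : C.Divisor} {U : C.X.Opens} [Nonempty U] (s : sections A U) (x : U) :
    s.1 x = sectionValue s :=
  s.2.1 _ _

theorem eq_zero_of_sectionValue_eq_zero {A : C.Divisor} {U : C.X.Opens} [Nonempty U]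
    {s : sections A U} (h : sectionValue s = 0) : s = 0 :=
  Subtype.ext (funext fun x ↦ (sectionValue_eq s x).trans h)

theorem sectionValue_injective {A : C.Divisor} {U : C.X.Opens} [Nonempty U] {s t : sections A U}
    (h : sectionValue s = sectionValue t) : s = t :=
  Subtype.ext (funext fun x ↦ (sectionValue_eq s x).trans (h.trans (sectionValue_eq t x).symm))

theorem sectionValue_smul {A : C.Divisor} {U : C.X.Opens} [Nonempty U] (a : Γ(C.X, U))
    (s : sections A U) : sectionValue (a • s) = C.X.germToFunctionField U a * sectionValue s := by
  unfold sectionValue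
  rw [smul_apply, Scheme.algebraMap_germ_eq_germToFunctionField]

theorem sectionValue_restrict {A : C.Divisor} {U V : C.X.Opens} [Nonempty U] [Nonempty V]
    (i : V ≤ U) (s : sections A U) : sectionValue (restrictSections A i s) = sectionValue s := rfl

theorem regularAt_sectionValue {A : C.Divisor} {U : C.X.Opens} [Nonempty U] (s : sections A U)
    (P : C.Point) (hP : P.1 ∈ U) : RegularAt A P (sectionValue s) :=
  sectionValue_eq s ⟨P.1, hP⟩ ▸ s.2.2 P hP

/-- The section of `𝒪_X(A)` given by a rational function. -/
def mkSection {A : C.Divisor} {U : C.X.Opens} (f : C.X.functionField)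
    (hf : ∀ P : C.Point, P.1 ∈ U → RegularAt A P f) : sections A U :=
  ⟨fun _ ↦ f, fun _ _ ↦ rfl, hf⟩

/-- `𝒪_X(A)` has near `P` a section of the smallest possible order `-A(P)`: a power of a
uniformizer, on an open set that avoids the remaining zeros and poles. -/
theorem exists_local_generator (A : C.Divisor) (P : C.Point) :
    ∃ (U : C.X.Opens) (_ : P.1 ∈ U) (f : C.X.functionField), f ≠ 0 ∧ C.ord P f = - A P ∧
      ∀ Q : C.Point, Q.1 ∈ U → RegularAt A Q f := by
  obtain ⟨t, ht, ht1⟩ := exists_ord_eq_one P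
  have hf : t ^ (- A P) ≠ 0 := zpow_ne_zero _ ht
  have hord : C.ord P (t ^ (- A P)) = - A P := by rw [ord_zpow P ht, ht1, mul_one]
  have hfin : ({Q : C.Point | C.ord Q (t ^ (- A P)) ≠ 0} ∪ A.support).Finite :=
    (finite_ord_ne_zero hf).union A.support.finite_toSet
  obtain ⟨U, hPU, hU⟩ := exists_open_avoiding (hfin.sdiff (t := {P})) (P := P) (by simp)
  refine ⟨U, hPU, _, hf, hord, fun Q hQ ↦ Or.inr ?_⟩
  by_cases hQP : Q = P
  · rw [hQP, hord]; omega
  have hQ' : ¬ (Q ∈ {Q : C.Point | C.ord Q (t ^ (- A P)) ≠ 0} ∪ (A.support : Set C.Point)) :=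
    fun h ↦ hU Q ⟨h, hQP⟩ hQ
  simp only [Set.mem_union, Set.mem_ofPred_eq, not_or, not_not, Finset.mem_coe,
    Finsupp.mem_support_iff] at hQ'
  rw [hQ'.1, hQ'.2, add_zero]

/-- The action of a morphism `𝒪_X(A) ⟶ 𝒪_X(B)` on sections over `U`. -/
def mapSections {A B : C.Divisor} (φ : lineBundle A ⟶ lineBundle B) (U : C.X.Opens) :
    sections A U →+ sections B U :=
  (φ.app U).hom

theorem mapSections_smul {A B : C.Divisor} (φ : lineBundle A ⟶ lineBundle B) (U : C.X.Opens)
    (a : Γ(C.X, U)) (s : sections A U) : mapSections φ U (a • s) = a • mapSections φ U s :=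
  Scheme.Modules.Hom.app_smul φ a s

theorem mapSections_restrict {A B : C.Divisor} (φ : lineBundle A ⟶ lineBundle B)
    {U V : C.X.Opens} (i : V ≤ U) (s : sections A U) :
    mapSections φ V (restrictSections A i s) = restrictSections B i (mapSections φ U s) :=
  congrArg (fun f ↦ f.hom s) (φ.mapPresheaf.naturality (homOfLE i).op)

theorem mapSections_inv_hom {A B : C.Divisor} (φ : lineBundle A ≅ lineBundle B) (U : C.X.Opens)
    (s : sections A U) : mapSections φ.inv U (mapSections φ.hom U s) = s :=
  congrArg (fun f : lineBundle A ⟶ lineBundle A ↦ (f.app U).hom s) φ.hom_inv_id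

/-- A morphism `𝒪_X(A) ⟶ 𝒪_X(B)` is the multiplication by a rational function. The point `P` only
serves to supply a nonzero section. -/
theorem exists_sectionValue_mapSections {A B : C.Divisor} (φ : lineBundle A ⟶ lineBundle B)
    (P : C.Point) :
    ∃ f : C.X.functionField, ∀ (U : C.X.Opens) (_ : Nonempty U) (s : sections A U),
      sectionValue (mapSections φ U s) = f * sectionValue s := by
  obtain ⟨U₀, hU₀, g, hg, -, hreg⟩ := exists_local_generator A P
  have : Nonempty U₀ := ⟨⟨P.1, hU₀⟩⟩
  let s₀ : sections A U₀ := mkSection g hreg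
  have hs₀ : sectionValue s₀ = g := rfl
  refine ⟨sectionValue (mapSections φ U₀ s₀) / g, fun U _ s ↦ ?_⟩
  by_cases hs : sectionValue s = 0
  · obtain rfl := eq_zero_of_sectionValue_eq_zero hs
    rw [map_zero, show sectionValue (0 : sections A U) = 0 from rfl, mul_zero]
    rfl
  -- On a smaller open set the two sections differ by a unit of the structure sheaf.
  obtain ⟨W, -, a, hW, ha, -⟩ := exists_isUnit_germ_eq C.X (sectionValue s / g)
    (div_ne_zero hs hg)
  let V : C.X.Opens := W ⊓ (U ⊓ U₀)
  have : Nonempty V := ⟨⟨genericPoint C.X, genericPoint_mem W, genericPoint_mem U,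
    genericPoint_mem U₀⟩⟩
  have hVW : V ≤ W := inf_le_left
  have hVU : V ≤ U := inf_le_right.trans inf_le_left
  have hVU₀ : V ≤ U₀ := inf_le_right.trans inf_le_right
  let b : Γ(C.X, V) := C.X.presheaf.map (homOfLE hVW).op a
  have hb : C.X.germToFunctionField V b = sectionValue s / g := by
    rw [← ha]
    exact C.X.presheaf.germ_res_apply (homOfLE hVW) _ _ a
  have hres : restrictSections A hVU s = b • restrictSections A hVU₀ s₀ := by
    refine sectionValue_injective ?_
    rw [sectionValue_smul, hb, sectionValue_restrict, sectionValue_restrict, hs₀,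
      div_mul_cancel₀ _ hg]
  have h1 := congrArg (fun r ↦ sectionValue (mapSections φ V r)) hres
  simp only [mapSections_smul, mapSections_restrict, sectionValue_smul, sectionValue_restrict,
    hb] at h1
  rw [h1]
  field_simp

/-- Isomorphic line bundles belong to linearly equivalent divisors: an isomorphism and its inverse
are multiplications by inverse functions `f` and `g`, and comparing local generators bounds the
order of `f` at each point from both sides. -/
theorem linEquiv_of_iso {A B : C.Divisor} (φ : lineBundle A ≅ lineBundle B) [Nonempty C.Point] :
    LinEquiv A B := by
  obtain ⟨f, hf⟩ := exists_sectionValue_mapSections φ.hom (Classical.arbitrary _)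
  obtain ⟨g, hg⟩ := exists_sectionValue_mapSections φ.inv (Classical.arbitrary _)
  have hgf : g * f = 1 := by
    obtain ⟨U, hU, r, hr, -, hreg⟩ := exists_local_generator A (Classical.arbitrary _)
    have : Nonempty U := ⟨⟨_, hU⟩⟩
    let s : sections A U := mkSection r hreg
    have h := hg U this (mapSections φ.hom U s)
    rw [mapSections_inv_hom, hf, show sectionValue s = r from rfl, ← mul_assoc] at h
    exact mul_right_cancel₀ hr (h.symm.trans (one_mul r).symm)
  have hf0 : f ≠ 0 := right_ne_zero_of_mul_eq_one hgf
  have hg0 : g ≠ 0 := left_ne_zero_of_mul_eq_one hgf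
  -- A local generator of `A` at `P` is mapped to a section of `B`, which bounds the multiplier.
  have key : ∀ {A B : C.Divisor} (ψ : lineBundle A ⟶ lineBundle B) {f : C.X.functionField},
      f ≠ 0 → (∀ (U : C.X.Opens) (_ : Nonempty U) (s : sections A U),
        sectionValue (mapSections ψ U s) = f * sectionValue s) →
      ∀ P, A P ≤ B P + C.ord P f := by
    intro A B ψ f hf0 hf P
    obtain ⟨U, hU, r, hr, hord, hreg⟩ := exists_local_generator A P
    have : Nonempty U := ⟨⟨_, hU⟩⟩
    let s : sections A U := mkSection r hreg
    have h := regularAt_sectionValue (mapSections ψ U s) P hU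
    rw [hf, show sectionValue s = r from rfl] at h
    rcases h with h | h
    · exact absurd h (mul_ne_zero hf0 hr)
    · rw [ord_mul P hf0 hr] at h
      omega
  refine ⟨f, hf0, fun P ↦ le_antisymm (key φ.hom hf0 hf P) ?_⟩
  have h1 := key φ.inv hg0 hg P
  have h2 := ord_mul P hg0 hf0
  rw [hgf, ord_one] at h2
  omega

theorem IsCanonical.linEquiv {K K' : C.Divisor} (hK : IsCanonical K) (hK' : IsCanonical K')
    [Nonempty C.Point] : LinEquiv K' K := by
  obtain ⟨ω, hω, h⟩ := hK
  obtain ⟨ω', hω', h'⟩ := hK'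
  -- Both differentials are multiples of `dt`, so one is a multiple of the other.
  obtain ⟨f, hf, hff⟩ : ∃ f : C.X.functionField, f ≠ 0 ∧ ω' = f • ω := by
    obtain ⟨t, -, ht⟩ := exists_ord_eq_one (Classical.arbitrary C.Point)
    obtain ⟨g, hg, -⟩ := h _ t ht
    obtain ⟨g', hg', -⟩ := h' _ t ht
    have hg0 : g ≠ 0 := fun h0 ↦ hω (by rw [hg, h0, zero_smul])
    have hg0' : g' ≠ 0 := fun h0 ↦ hω' (by rw [hg', h0, zero_smul])
    exact ⟨g' / g, div_ne_zero hg0' hg0, by rw [hg, hg', smul_smul, div_mul_cancel₀ _ hg0]⟩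
  refine ⟨f, hf, fun P ↦ ?_⟩
  obtain ⟨t, -, ht⟩ := exists_ord_eq_one P
  obtain ⟨g, hg, hgP⟩ := h _ t ht
  obtain ⟨g', hg', hgP'⟩ := h' _ t ht
  have hg0 : g ≠ 0 := fun h0 ↦ hω (by rw [hg, h0, zero_smul])
  have hdt : KaehlerDifferential.D k C.X.functionField t ≠ 0 :=
    fun h0 ↦ hω (by rw [hg, h0, smul_zero])
  have hgg : g' = f * g := by
    refine smul_left_injective _ hdt ?_
    change g' • _ = (f * g) • _
    rw [← hg', hff, hg, smul_smul]
  rw [hgP, hgP', hgg, ord_mul P hf hg0, add_comm]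

/-- Two presentations of the same line bundle give linearly equivalent effective divisors. -/
theorem IsPresentation.linEquiv {L : C.X.Modules} {D E D' E' : C.Divisor} [Nonempty C.Point]
    (h : IsPresentation L D E) (h' : IsPresentation L D' E') : LinEquiv (D + E') (D' + E) := by
  obtain ⟨K, hK, ⟨e⟩⟩ := h.iso
  obtain ⟨K', hK', ⟨e'⟩⟩ := h'.iso
  obtain ⟨f, hf, hfP⟩ := linEquiv_of_iso (e'.symm ≪≫ e)
  obtain ⟨g, hg, hgP⟩ := hK'.linEquiv hK
  refine ⟨f * g, mul_ne_zero hf hg, fun P ↦ ?_⟩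
  have h1 := hfP P
  have h2 := hgP P
  rw [ord_mul P hf hg]
  simp only [Finsupp.add_apply, Finsupp.sub_apply] at h1 ⊢
  omega

/-! ### Values of functions at a closed point -/

theorem isDiscreteValuationRing_stalk_of_not_isField (x : C.X)
    (hx : ¬ IsField (C.X.presheaf.stalk x)) : IsDiscreteValuationRing (C.X.presheaf.stalk x) := by
  obtain ⟨U, hU, V, hV, hxV, e, hf⟩ :=
    C.isSmooth.exists_isStandardSmoothOfRelativeDimension x
  have hUne : Nonempty U := ⟨⟨C.str x, e hxV⟩⟩
  have : Subsingleton (Spec (CommRingCat.of k)) :=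
    inferInstanceAs (Subsingleton (PrimeSpectrum k))
  have : Subsingleton U.toScheme := ⟨fun x y ↦ Subtype.ext
    (Subsingleton.elim (α := Spec (CommRingCat.of k)) x.1 y.1)⟩
  have hfld : IsField Γ(Spec (CommRingCat.of k), U) := by
    have h := isField_of_isIntegral_of_subsingleton U.toScheme
    exact MulEquiv.isField h (U.topIso.commRingCatIsoToRingEquiv.symm.toMulEquiv)
  let := hfld.toField
  let := (C.str.appLE U V e).hom.toAlgebra
  have : Algebra.IsStandardSmoothOfRelativeDimension 1 Γ(Spec (CommRingCat.of k), U) Γ(C.X, V) :=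
    hf
  let := TopCat.Presheaf.algebra_section_stalk C.X.presheaf (⟨x, hxV⟩ : V)
  have := hV.isLocalization_stalk ⟨x, hxV⟩
  exact isDiscreteValuationRing_of_isStandardSmooth Γ(Spec (CommRingCat.of k), U) Γ(C.X, V) _
    (hV.primeIdealOf ⟨x, hxV⟩).asIdeal hx

/-- Points of codimension one are only required to have coheight one, so that one of them is
topologically closed needs an argument: a closed point in the closure of any of them is not
generic, hence its local ring, being a discrete valuation ring, has dimension one. -/
theorem exists_isClosed_point [h : Nonempty C.Point] : ∃ P : C.Point, IsClosed {P.1} := by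
  obtain ⟨P⟩ := h
  obtain ⟨x, hx, hcl⟩ := IsClosed.exists_closed_singleton (isClosed_closure (s := {P.1}))
    ⟨P.1, subset_closure rfl⟩
  have hle : x ≤ P.1 := specializes_iff_mem_closure.mpr hx
  have hco : (1 : ℕ∞) ≤ Order.coheight x := P.2 ▸ Order.coheight_anti hle
  have hfield : ¬ IsField (C.X.presheaf.stalk x) := fun hf ↦ by
    have h0 := ringKrullDim_eq_zero_of_isField hf
    rw [ringKrullDim_stalk_eq_coheight] at h0
    have : Order.coheight x = 0 := by exact_mod_cast h0
    rw [this] at hco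
    exact absurd hco (by decide)
  have := isDiscreteValuationRing_stalk_of_not_isField x hfield
  have h1 := IsDiscreteValuationRing.ringKrullDim_eq_one (C.X.presheaf.stalk x)
  rw [ringKrullDim_stalk_eq_coheight] at h1
  exact ⟨⟨x, by exact_mod_cast h1⟩, hcl⟩

/-- The inclusion of the constants in the local ring at `P`. -/
def constants (P : C.Point) : k →+* C.X.presheaf.stalk P.1 :=
  (C.X.presheaf.germ ⊤ P.1 trivial).hom.comp
    (C.str.appTop.hom.comp (Scheme.ΓSpecIso (CommRingCat.of k)).inv.hom)

theorem algebraMap_constants (P : C.Point) (c : k) :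
    algebraMap _ C.X.functionField (constants P c) = algebraMap k C.X.functionField c := by
  have : Nonempty (⊤ : C.X.Opens) := ⟨⟨P.1, trivial⟩⟩
  exact Scheme.algebraMap_germ_eq_germToFunctionField C.X (U := ⊤) (x := P.1) trivial _

/-- Over an algebraically closed field a regular function has a value at a closed point. -/
theorem exists_sub_constants_mem_maximalIdeal [IsAlgClosed k] {P : C.Point}
    (hP : IsClosed {P.1}) (a : C.X.presheaf.stalk P.1) :
    ∃ c : k, a - constants P c ∈ IsLocalRing.maximalIdeal (C.X.presheaf.stalk P.1) := by
  let ι := residueFieldIsoBase C.str P.1 hP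
  have key : CommRingCat.ofHom (constants P) ≫ C.X.residue P.1 = ι.inv := by
    refine Spec.map_injective ?_
    have hstr : C.str = C.X.toSpecΓ ≫
        Spec.map ((Scheme.ΓSpecIso (CommRingCat.of k)).inv ≫ C.str.appTop) := by
      rw [Spec.map_comp, ← Scheme.toSpecΓ_naturality_assoc, ← SpecMap_ΓSpecIso_hom,
        ← Spec.map_comp, Iso.inv_hom_id, Spec.map_id, Category.comp_id]
    rw [SpecMap_residueFieldIsoBase_inv, Spec.map_comp, Scheme.fromSpecResidueField,
      Category.assoc]
    congr 1
    rw [hstr, Scheme.fromSpecStalk_toSpecΓ_assoc, ← Spec.map_comp]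
    rfl
  refine ⟨ι.hom (C.X.residue P.1 a), ?_⟩
  rw [← IsLocalRing.residue_eq_zero_iff, map_sub, sub_eq_zero]
  have := congrArg (fun φ ↦ φ.hom (ι.hom (C.X.residue P.1 a))) key
  exact (this.trans (ι.hom_inv_id_apply _)).symm

/-! ### Linear systems and the gonality -/

/-- The space `L(A - P)` has codimension at most one in `L(A)`: if `g` has the smallest possible
order at `P` and `c` is the value of `f / g` at `P`, then `f - c g` lies in `L(A - P)`. -/
theorem exists_sub_smul_mem_riemannRochSpace [IsAlgClosed k] {A : C.Divisor} {P : C.Point}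
    (hP : IsClosed {P.1}) {f g : C.X.functionField} (hf : f ∈ riemannRochSpace A)
    (hg : g ∈ riemannRochSpace A)
    (hgP : g ∉ riemannRochSpace (A - Finsupp.single P 1)) :
    ∃ c : k, f - c • g ∈ riemannRochSpace (A - Finsupp.single P 1) := by
  have hmem : ∀ h ∈ riemannRochSpace A, RegularAt (A - Finsupp.single P 1) P h →
      h ∈ riemannRochSpace (A - Finsupp.single P 1) := by
    intro h hh hhP Q
    by_cases hQ : Q = P
    · exact hQ ▸ hhP
    · refine (hh Q).imp id fun h' ↦ ?_
      simpa [Finsupp.single_apply, Ne.symm hQ] using h'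
  have hg0 : g ≠ 0 := fun h ↦ hgP (h ▸ zero_mem _)
  have hgord : C.ord P g = - A P := by
    have h1 : ¬ RegularAt (A - Finsupp.single P 1) P g := fun h ↦ hgP (hmem g hg h)
    have h2 := (hg P).resolve_left hg0
    simp only [RegularAt, hg0, false_or, Finsupp.sub_apply, Finsupp.single_eq_same] at h1
    omega
  by_cases hf0 : f = 0
  · exact ⟨0, by simp [hf0]⟩
  have hfg : 0 ≤ C.ord P (f / g) := by
    rw [div_eq_mul_inv, ord_mul P hf0 (inv_ne_zero hg0), ord_inv P hg0, hgord]
    have := (hf P).resolve_left hf0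
    omega
  obtain ⟨a, ha⟩ := exists_stalk_eq P hfg
  obtain ⟨c, hc⟩ := exists_sub_constants_mem_maximalIdeal hP a
  refine ⟨c, hmem _ (sub_mem hf (Submodule.smul_mem _ _ hg)) ?_⟩
  have hval : f - c • g = algebraMap _ C.X.functionField (a - constants P c) * g := by
    rw [map_sub, ha, algebraMap_constants, Algebra.smul_def, sub_mul, div_mul_cancel₀ _ hg0]
  rw [hval]
  by_cases h0 : a - constants P c = 0
  · exact Or.inl (by rw [h0, map_zero, zero_mul])
  right
  have hinj := FaithfulSMul.algebraMap_injective (C.X.presheaf.stalk P.1) C.X.functionField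
  rw [ord_mul P ((map_ne_zero_iff _ hinj).mpr h0) hg0, hgord, Finsupp.sub_apply,
    Finsupp.single_eq_same]
  have := ord_pos_of_mem_maximalIdeal P h0 hc
  omega

/-- The divisor `A` need not be effective here: any two independent elements of `L(A)` span a
pencil of degree `deg A`. -/
theorem gonality_le {A : C.Divisor} {n : ℕ} (hA : deg A = n) {f g : C.X.functionField}
    (hf : f ∈ riemannRochSpace A) (hg : g ∈ riemannRochSpace A)
    (hfg : LinearIndependent k ![f, g]) : C.gonality ≤ n := by
  refine Nat.sInf_le ⟨_, A, Submodule.span k (Set.range ![f, g]), ?_, ?_, hA, rfl⟩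
  · rw [Submodule.span_le]
    rintro _ ⟨i, rfl⟩
    fin_cases i
    · exact hf
    · exact hg
  · rw [finrank_span_eq_card hfg, Fintype.card_fin]

theorem deg_add (A B : C.Divisor) : deg (A + B) = deg A + deg B :=
  Finsupp.sum_add_index' (fun _ ↦ rfl) fun _ _ _ ↦ rfl

theorem deg_single (P : C.Point) (n : ℤ) : deg (Finsupp.single P n) = n :=
  Finsupp.sum_single_index rfl

theorem deg_nonneg {A : C.Divisor} (hA : 0 ≤ A) : 0 ≤ deg A :=
  Finset.sum_nonneg fun P _ ↦ hA P

theorem deg_pos {A : C.Divisor} (hA : 0 ≤ A) (h0 : A ≠ 0) : 0 < deg A := by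
  obtain ⟨P, hP⟩ := Finsupp.ne_iff.mp h0
  refine Finset.sum_pos' (fun P _ ↦ hA P) ⟨P, Finsupp.mem_support_iff.mpr hP, ?_⟩
  exact lt_of_le_of_ne (hA P) (Ne.symm hP)

/-- Two distinct members of a linear system differ by the divisor of a function `f` that is not
constant, so `1` and `f` are independent in `L(A)`. -/
theorem LinEquiv.exists_linearIndependent {A B : C.Divisor} (hA : 0 ≤ A) (hB : 0 ≤ B)
    (h : LinEquiv B A) (hne : A ≠ B) :
    ∃ f ∈ riemannRochSpace A, ∃ g ∈ riemannRochSpace A, LinearIndependent k ![f, g] := by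
  obtain ⟨f, hf, hfP⟩ := h
  refine ⟨1, fun P ↦ Or.inr (by rw [ord_one, zero_add]; exact hA P), f,
    fun P ↦ Or.inr (by rw [add_comm, ← hfP]; exact hB P), ?_⟩
  rw [LinearIndependent.pair_iff' one_ne_zero]
  intro c hc
  rw [← Algebra.algebraMap_eq_smul_one] at hc
  have hc0 : c ≠ 0 := by
    rintro rfl
    exact hf (by rw [← hc, map_zero])
  refine hne (Finsupp.ext fun P ↦ ?_)
  rw [hfP P, ← hc, ord_algebraMap P hc0, add_zero]

theorem LinEquiv.gonality_le_deg {A B : C.Divisor} (hA : 0 ≤ A) (hB : 0 ≤ B)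
    (h : LinEquiv B A) (hne : A ≠ B) : (C.gonality : ℤ) ≤ deg A := by
  obtain ⟨f, hf, g, hg, hfg⟩ := h.exists_linearIndependent hA hB hne
  have hn : deg A = (deg A).toNat := (Int.toNat_of_nonneg (deg_nonneg hA)).symm
  have := gonality_le hn hf hg hfg
  omega

/-- A complete linear system with two distinct members, of degree equal to the gonality, is a
pencil: subtracting a point lowers the dimension by at most one, and brings the degree below the
gonality. Finiteness of the dimension of `L(A)` is part of the proof, since `h0` is a `finrank`. -/
theorem h0_eq_two [IsAlgClosed k] {A B : C.Divisor} (hA : 0 ≤ A) (hB : 0 ≤ B) (h : LinEquiv B A)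
    (hne : A ≠ B) (hdeg : deg A = C.gonality) (hpos : 0 < deg A) : h0 A = 2 := by
  obtain ⟨Q, -⟩ : ∃ Q, A Q ≠ B Q := Finsupp.ne_iff.mp hne
  have : Nonempty C.Point := ⟨Q⟩
  obtain ⟨P, hP⟩ := exists_isClosed_point (C := C)
  let M := riemannRochSpace (A - Finsupp.single P 1)
  have hM : Module.rank k M ≤ 1 := by
    by_contra! hlt
    have : Nontrivial M := rank_pos_iff_nontrivial.mp (zero_lt_one.trans hlt)
    obtain ⟨x, hx⟩ := exists_ne (0 : M)
    obtain ⟨y, hxy⟩ := exists_linearIndependent_pair_of_one_lt_rank hlt hx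
    have hind : LinearIndependent k ![x.1, y.1] := by
      rw [LinearIndependent.pair_iff' fun h ↦ hx (Subtype.ext h)]
      exact fun c hc ↦ (LinearIndependent.pair_iff' hx).mp hxy c (Subtype.ext hc)
    have hd : deg (A - Finsupp.single P 1) = ((C.gonality - 1 : ℕ) : ℤ) := by
      have h1 := deg_add (A - Finsupp.single P 1) (Finsupp.single P 1)
      rw [sub_add_cancel, deg_single] at h1
      omega
    have := gonality_le hd x.2 y.2 hind
    omega
  obtain ⟨v, -, hv⟩ := (rank_submodule_le_one_iff M).mp hM
  obtain ⟨g, hg⟩ : ∃ g, riemannRochSpace A ≤ Submodule.span k (Set.range ![v, g]) := by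
    by_cases hall : riemannRochSpace A ≤ M
    · refine ⟨0, (hall.trans hv).trans (Submodule.span_mono ?_)⟩
      rintro _ rfl
      exact ⟨0, rfl⟩
    · obtain ⟨g, hg, hgM⟩ := SetLike.not_le_iff_exists.mp hall
      refine ⟨g, fun f hf ↦ ?_⟩
      obtain ⟨c, hc⟩ := exists_sub_smul_mem_riemannRochSpace hP hf hg hgM
      rw [← sub_add_cancel f (c • g)]
      refine add_mem (Submodule.span_mono ?_ (hv hc))
        (Submodule.smul_mem _ _ (Submodule.subset_span ⟨1, rfl⟩))
      rintro _ rfl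
      exact ⟨0, rfl⟩
  have hfin : Module.Finite k (Submodule.span k (Set.range ![v, g])) :=
    Module.Finite.span_of_finite k (Set.finite_range _)
  have hfin' : Module.Finite k (riemannRochSpace A) := Submodule.finiteDimensional_of_le hg
  refine le_antisymm ?_ ?_
  · refine (Submodule.finrank_mono hg).trans ?_
    exact (finrank_range_le_card ![v, g])
  · obtain ⟨x, hx, y, hy, hxy⟩ := h.exists_linearIndependent hA hB hne
    have hle : Submodule.span k (Set.range ![x, y]) ≤ riemannRochSpace A := by
      rw [Submodule.span_le]
      rintro _ ⟨i, rfl⟩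
      fin_cases i
      · exact hx
      · exact hy
    have := Submodule.finrank_mono hle
    rwa [finrank_span_eq_card hxy, Fintype.card_fin] at this

theorem LinEquiv.completeLinearSystem_eq {A B : C.Divisor} (h : LinEquiv A B) :
    completeLinearSystem A = completeLinearSystem B :=
  Set.ext fun _ ↦ ⟨fun hD ↦ ⟨hD.1, hD.2.trans h⟩, fun hD ↦ ⟨hD.1, hD.2.trans h.symm⟩⟩

theorem isLinearSeries_completeLinearSystem {A : C.Divisor} {n : ℕ} (hA : deg A = n)
    (h : h0 A = 2) : IsLinearSeries 1 n (completeLinearSystem A) := by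
  refine ⟨A, riemannRochSpace A, le_rfl, h, hA, Set.ext fun B ↦ ⟨?_, ?_⟩⟩
  · rintro ⟨hB, f, hf, hfP⟩
    exact ⟨f, fun P ↦ Or.inr (by rw [add_comm, ← hfP]; exact hB P), hf, hfP⟩
  · rintro ⟨f, hfA, hf, hfP⟩
    refine ⟨fun P ↦ ?_, f, hf, hfP⟩
    rw [hfP, add_comm]
    exact (hfA P).resolve_left hf

theorem linEquiv_of_completeLinearSystem_eq {A B : C.Divisor} (hA : 0 ≤ A)
    (h : completeLinearSystem A = completeLinearSystem B) : LinEquiv A B := by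
  have : A ∈ completeLinearSystem A := ⟨hA, 1, one_ne_zero, fun P ↦ by rw [ord_one, add_zero]⟩
  rw [h] at this
  exact this.2

theorem LinEquiv.of_add_left {A B D : C.Divisor} (h : LinEquiv (D + A) (D + B)) :
    LinEquiv A B := by
  obtain ⟨f, hf, hfP⟩ := h
  refine ⟨f, hf, fun P ↦ ?_⟩
  have := hfP P
  simp only [Finsupp.add_apply] at this
  omega

theorem eq_of_add_eq_add {D E D' E' : C.Divisor} (h : D ⊓ E = 0) (h' : D' ⊓ E' = 0)
    (heq : D + E' = D' + E) : D = D' ∧ E = E' := by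
  have key : ∀ P, D P = D' P ∧ E P = E' P := fun P ↦ by
    have h1 := DFunLike.congr_fun h P
    have h2 := DFunLike.congr_fun h' P
    have h3 := DFunLike.congr_fun heq P
    simp only [Finsupp.inf_apply, Finsupp.add_apply, Finsupp.zero_apply] at h1 h2 h3
    omega
  exact ⟨Finsupp.ext fun P ↦ (key P).1, Finsupp.ext fun P ↦ (key P).2⟩

/-- Two distinct presentations of a line bundle exhibit a pencil in `|D + E'|`. -/
theorem IsPresentation.gonality_le_deg {L : C.X.Modules} {D E D' E' : C.Divisor}
    [Nonempty C.Point] (h : IsPresentation L D E) (h' : IsPresentation L D' E')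
    (hne : (D', E') ≠ (D, E)) : (C.gonality : ℤ) ≤ deg D + deg E' := by
  rw [← deg_add]
  refine (h.linEquiv h').symm.gonality_le_deg (add_nonneg h.nonneg h'.pos.le)
    (add_nonneg h'.nonneg h.pos.le) fun heq ↦ hne ?_
  obtain ⟨rfl, rfl⟩ := eq_of_add_eq_add h.gcd_eq_zero h'.gcd_eq_zero heq
  rfl

end SmoothCurve

end

theorem theorem2p5 {k : Type u} [Field k] [IsAlgClosed k] [CharZero k] (C : SmoothCurve k)
    (L : C.X.Modules) (hL : SmoothCurve.IsLineBundle L) (hns : SmoothCurve.IsNonspecial L)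
    (D E : C.Divisor) (hpres : SmoothCurve.IsPresentation L D E)
    (hD : D ≠ 0) (hE : SmoothCurve.h0 E = 1) :
    (SmoothCurve.deg D + SmoothCurve.deg E ≤ C.gonality →
      SmoothCurve.IsMinimalPresentation L D E) ∧
    (SmoothCurve.deg D + SmoothCurve.deg E < C.gonality →
      SmoothCurve.IsMinimalPresentation L D E ∧
      ∀ D' E' : C.Divisor, SmoothCurve.IsMinimalPresentation L D' E' → D' = D ∧ E' = E) ∧
    (SmoothCurve.deg D + SmoothCurve.deg E = C.gonality →
      ∀ (J : Type*) (D' E' : J → C.Divisor),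
        (∀ j, SmoothCurve.IsPresentation L (D' j) (E' j) ∧
          SmoothCurve.deg (D' j) = SmoothCurve.deg D ∧
          SmoothCurve.deg (E' j) = SmoothCurve.deg E ∧ (D' j, E' j) ≠ (D, E)) →
        (Function.Injective fun j ↦ (D' j, E' j)) →
        (∀ j, SmoothCurve.completeLinearSystem (D + E' j) =
            SmoothCurve.completeLinearSystem (D' j + E) ∧
          SmoothCurve.IsLinearSeries 1 C.gonality
            (SmoothCurve.completeLinearSystem (D + E' j)) ∧
          SmoothCurve.h0 (D + E' j) = 2) ∧
        Function.Injective fun j ↦ SmoothCurve.completeLinearSystem (D + E' j)) := by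
  obtain ⟨P₀, -⟩ : ∃ P, D P ≠ (0 : C.Divisor) P := Finsupp.ne_iff.mp hD
  have : Nonempty C.Point := ⟨P₀⟩
  have hdD := SmoothCurve.deg_pos hpres.nonneg hD
  have hdE := SmoothCurve.deg_pos hpres.pos.le hpres.pos.ne'
  have hmin : SmoothCurve.deg D + SmoothCurve.deg E ≤ C.gonality →
      SmoothCurve.IsMinimalPresentation L D E := by
    refine fun hle ↦ ⟨hpres, fun D' E' h' ↦ ?_⟩
    by_cases hne : (D', E') = (D, E)
    · exact (congrArg (fun p ↦ SmoothCurve.deg p.2) hne).ge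
    · have := hpres.gonality_le_deg h' hne
      omega
  refine ⟨hmin, fun hlt ↦ ⟨hmin hlt.le, fun D' E' h' ↦ ?_⟩, fun heq J D' E' hJ hinj ↦ ?_⟩
  · by_contra hne
    have h1 := h'.deg_le D E hpres
    have h2 := hpres.gonality_le_deg h'.isPresentation fun h ↦ hne (Prod.ext_iff.mp h)
    omega
  have hD' : ∀ j, 0 ≤ D' j := fun j ↦ (hJ j).1.nonneg
  have hE' : ∀ j, 0 ≤ E' j := fun j ↦ (hJ j).1.pos.le
  have hDE' : ∀ j, 0 ≤ D + E' j := fun j ↦ add_nonneg hpres.nonneg (hE' j)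
  have hlin : ∀ j, SmoothCurve.LinEquiv (D + E' j) (D' j + E) := fun j ↦ hpres.linEquiv (hJ j).1
  have hdeg : ∀ j, SmoothCurve.deg (D + E' j) = C.gonality := fun j ↦ by
    rw [SmoothCurve.deg_add, (hJ j).2.2.1, heq]
  refine ⟨fun j ↦ ?_, fun i j hij ↦ ?_⟩
  · have htwo : SmoothCurve.h0 (D + E' j) = 2 := by
      refine SmoothCurve.h0_eq_two (hDE' j) (add_nonneg (hD' j) hpres.pos.le) (hlin j).symm
        (fun h ↦ (hJ j).2.2.2 ?_) (hdeg j) (by rw [hdeg j]; omega)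
      obtain ⟨h1, h2⟩ := SmoothCurve.eq_of_add_eq_add hpres.gcd_eq_zero (hJ j).1.gcd_eq_zero h
      rw [h1, h2]
    exact ⟨(hlin j).completeLinearSystem_eq,
      SmoothCurve.isLinearSeries_completeLinearSystem (hdeg j) htwo, htwo⟩
  · -- If the pencils agree, then `E' i ~ E' j` and `D' i ~ D' j`; these divisors have degree less
    -- than the gonality, hence are equal.
    have hE : SmoothCurve.LinEquiv (D + E' j) (D + E' i) :=
      (SmoothCurve.linEquiv_of_completeLinearSystem_eq (hDE' i) hij).symm
    have hD : SmoothCurve.LinEquiv (E + D' j) (E + D' i) := by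
      rw [add_comm E, add_comm E]
      exact ((hlin j).symm.trans hE).trans (hlin i)
    refine hinj (Prod.ext ?_ ?_)
    · by_contra hne
      have := hD.of_add_left.gonality_le_deg (hD' i) (hD' j) hne
      have := (hJ i).2.1
      omega
    · by_contra hne
      have := hE.of_add_left.gonality_le_deg (hE' i) (hE' j) hne
      have := (hJ i).2.2.1
      omega
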